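/- Lemma (Poincaré inequality II). For every integer $n \ge 2$ there is a constant $C = C(n) > 0$, depending only on $n$, with the following property. Let $\Omega \subset \mathbb{R}^n$ be a bounded open set that is star shaped with respect to an open ball $B$ of positive radius, that is, $B \subset \Omega$ and for every $y \in \Omega$ the convex hull of $B \cup \{y\}$ is contained in $\Omega$. Then there is a constant $K \ge 0$ such that every real valued $u \in H^1(\Omega)$ with $\int_\Omega u \, dx = 0$ satisfies \[ \|u\|_{L^2(\Omega)} \le K \operatorname{diam}(\Omega)\, |u|_{H^1(\Omega)}, \qquad |u|_{H^1(\Omega)} = \Big( \sum_{i=1}^n \|\partial_i u\|_{L^2(\Omega)}^2 \Big)^{1/2}, \] where $\partial_i u$ are the weak partial derivatives, and \[ K \le C \, \frac{R}{\rho} \left[ 1 + \left( \log \frac{|\Omega|}{|B|} \right)^{\frac{n}{2(n-1)}} \left( \frac{|\Omega|}{|B|} \right)^{\frac{n-2}{2(n-1)}} \right], \] where $R = \operatorname{diam}(\Omega)$, $\rho = \operatorname{diam}(B)$ and $|\cdot|$ denotes Lebesgue measure. -/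

import Mathlib

open MeasureTheory Set
open scoped ContDiff

noncomputable section

/-- `Ω` is star shaped with respect to the set `B` (in the theorem, a ball): `B ⊆ Ω` and, for every
`y ∈ Ω`, the convex hull of `B ∪ {y}` is contained in `Ω`. -/
def IsStarShapedWrt {n : ℕ} (Ω B : Set (EuclideanSpace ℝ (Fin n))) : Prop :=
  B ⊆ Ω ∧ ∀ y ∈ Ω, convexHull ℝ (B ∪ {y}) ⊆ Ω

/-- The norm of `L²(Ω)`, with respect to Lebesgue measure. -/
def l2Norm {n : ℕ} (Ω : Set (EuclideanSpace ℝ (Fin n))) (u : EuclideanSpace ℝ (Fin n) → ℝ) : ℝ :=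
  (eLpNorm u 2 (volume.restrict Ω)).toReal

/-- `g ∈ L²(Ω)` is the weak partial derivative `∂ᵢ u` on the open set `Ω`:
`∫_Ω u ∂ᵢφ = - ∫_Ω g φ` for all test functions `φ ∈ C_c^∞(Ω)`. -/
def IsWeakPartial {n : ℕ} (Ω : Set (EuclideanSpace ℝ (Fin n))) (i : Fin n)
    (u g : EuclideanSpace ℝ (Fin n) → ℝ) : Prop :=
  MemLp g 2 (volume.restrict Ω) ∧
    ∀ φ : EuclideanSpace ℝ (Fin n) → ℝ, ContDiff ℝ ∞ φ → HasCompactSupport φ → tsupport φ ⊆ Ω →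
      ∫ x in Ω, u x * fderiv ℝ φ x (EuclideanSpace.single i 1) = - ∫ x in Ω, g x * φ x

/-- `u ∈ H¹(Ω)`: `u` and all its first order weak partial derivatives are in `L²(Ω)`. -/
def MemH1 {n : ℕ} (Ω : Set (EuclideanSpace ℝ (Fin n))) (u : EuclideanSpace ℝ (Fin n) → ℝ) : Prop :=
  MemLp u 2 (volume.restrict Ω) ∧ ∀ i : Fin n, ∃ g, IsWeakPartial Ω i u g

open Classical in
/-- The weak partial derivative `∂ᵢ u` (zero if it does not exist in `L²(Ω)`). -/
def weakPartial {n : ℕ} (Ω : Set (EuclideanSpace ℝ (Fin n))) (i : Fin n)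
    (u : EuclideanSpace ℝ (Fin n) → ℝ) : EuclideanSpace ℝ (Fin n) → ℝ :=
  if h : ∃ g, IsWeakPartial Ω i u g then h.choose else 0

/-- The seminorm of `H¹(Ω)`: `|u|_{H¹(Ω)} = (∑ᵢ ‖∂ᵢ u‖²_{L²(Ω)})^{1/2}`. -/
def h1Seminorm {n : ℕ} (Ω : Set (EuclideanSpace ℝ (Fin n)))
    (u : EuclideanSpace ℝ (Fin n) → ℝ) : ℝ :=
  Real.sqrt (∑ i : Fin n, l2Norm Ω (weakPartial Ω i u) ^ 2)

/-- Weak partial derivatives are unique almost everywhere, so that `h1Seminorm` does not depend on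
the choice made in `weakPartial`. -/
theorem IsWeakPartial.ae_eq_weakPartial {n : ℕ} {Ω : Set (EuclideanSpace ℝ (Fin n))}
    (hΩ : IsOpen Ω) {i : Fin n} {u g : EuclideanSpace ℝ (Fin n) → ℝ} (hg : IsWeakPartial Ω i u g) :
    g =ᵐ[volume.restrict Ω] weakPartial Ω i u := by
  have hex : ∃ g, IsWeakPartial Ω i u g := ⟨g, hg⟩
  have hw : IsWeakPartial Ω i u (weakPartial Ω i u) := by
    rw [weakPartial, dif_pos hex]
    exact hex.choose_spec
  generalize weakPartial Ω i u = w at hw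
  have hloc : ∀ f : EuclideanSpace ℝ (Fin n) → ℝ, MemLp f 2 (volume.restrict Ω) →
      LocallyIntegrable f (volume.restrict Ω) :=
    fun f hf => hf.locallyIntegrable (by norm_num)
  have key : ∀ᵐ x ∂(volume.restrict Ω), x ∈ Ω → (g - w) x = 0 := by
    refine hΩ.ae_eq_zero_of_integral_contDiff_smul_eq_zero
      (((hloc _ hg.1).sub (hloc _ hw.1)).locallyIntegrableOn Ω) ?_
    intro φ h1 h2 h3
    have hi : ∀ f, MemLp f 2 (volume.restrict Ω) →
        Integrable (fun x => φ x * f x) (volume.restrict Ω) := fun f hf => by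
      simpa using (hloc f hf).integrable_smul_left_of_hasCompactSupport h1.continuous h2
    have e := (hg.2 φ h1 h2 h3).symm.trans (hw.2 φ h1 h2 h3)
    simp only [Pi.sub_apply, smul_eq_mul, mul_sub]
    rw [integral_sub (hi g hg.1) (hi w hw.1)]
    simp only [mul_comm (φ _)]
    linarith
  filter_upwards [key, ae_restrict_mem hΩ.measurableSet] with x hx hxΩ
  have := hx hxΩ
  simp only [Pi.sub_apply] at this
  linarith

end

/-!
Join the points `y ∈ B` and `x ∈ Ω` by a segment, which stays in `Ω`, and integrate
`|u(y) - u(x)|² ≤ diam(Ω)² ∫₀¹ |∇u((1 - s)y + sx)|² ds` over `B × Ω`. Substituting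
`z = (1 - s)y + sx` in place of `x` when `s ≥ 1/2` and of `y` otherwise costs a Jacobian of at most
`2ⁿ`, so that
`∬_{B × Ω} |u(y) - u(x)|² ≤ 2ⁿ (|B| + |Ω|) diam(Ω)² ∫_Ω |∇u|²`.
Since `u` has mean zero, `∫_Ω |c - u|² ≥ ∫_Ω u²` for every constant `c`, so the left side is at
least `|B| ∫_Ω u²`. This gives the inequality with `K² = 2ⁿ (1 + |Ω|/|B|)`.

For `u ∈ H¹(Ω)` the estimate is applied to mollifications of `u`, with `B` and `Ω` replaced by the
sets of their points at distance at least `δ` from the complement: these are again star shaped with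
respect to one another. Then `δ → 0`, by Fatou's lemma.

Finally `√(|Ω|/|B|)` is bounded by the bracket of the theorem: with `V = |Ω|/|B|`,
`V^{1/2} = V^{1/(2(n-1))} V^{(n-2)/(2(n-1))}`, and `V ≤ (2R/ρ)ⁿ` bounds the first factor by `2R/ρ`.
-/

open Filter AffineMap ContinuousLinearMap
open scoped Convolution ENNReal Topology

section Lintegral

variable {α : Type*} [MeasurableSpace α] {μ : Measure α}

theorem rpow_lintegral_le_lintegral_rpow [IsProbabilityMeasure μ] {f : α → ℝ≥0∞}
    (hf : AEMeasurable f μ) {p : ℝ} (hp : 1 ≤ p) :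
    (∫⁻ x, f x ∂μ) ^ p ≤ ∫⁻ x, f x ^ p ∂μ := by
  have h := eLpNorm'_le_eLpNorm'_of_exponent_le one_pos hp μ hf.aestronglyMeasurable
  rw [← ENNReal.rpow_le_rpow_iff (zero_lt_one.trans_le hp),
    ← lintegral_rpow_enorm_eq_rpow_eLpNorm' (zero_lt_one.trans_le hp),
    eLpNorm'_eq_lintegral_enorm] at h
  simpa only [enorm_eq_self, ENNReal.rpow_one, one_div, inv_one] using h

theorem lintegral_le_of_aecover_of_ae_tendsto {ι : Type*} {l : Filter ι} [l.IsCountablyGenerated]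
    [l.NeBot] {s : ι → Set α} (hs : AECover μ l s)
    {f : ι → α → ℝ≥0∞} {g : α → ℝ≥0∞} {C : ℝ≥0∞} (hf : ∀ i, AEMeasurable (f i) μ)
    (hlim : ∀ᵐ x ∂μ, Tendsto (fun i => f i x) l (𝓝 (g x)))
    (hC : ∀ i, ∫⁻ x in s i, f i x ∂μ ≤ C) : ∫⁻ x, g x ∂μ ≤ C := by
  obtain ⟨i, hi⟩ := l.exists_seq_tendsto
  have hliminf : ∀ᵐ x ∂μ, g x = liminf (fun k => (s (i k)).indicator (f (i k)) x) atTop := by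
    filter_upwards [hlim, hs.ae_eventually_mem] with x hx hmem
    have hx' : Tendsto (fun j => (s j).indicator (f j) x) l (𝓝 (g x)) :=
      hx.congr' (hmem.mono fun j hj => (indicator_of_mem hj _).symm)
    exact (hx'.comp hi).liminf_eq.symm
  calc ∫⁻ x, g x ∂μ
      = ∫⁻ x, liminf (fun k => (s (i k)).indicator (f (i k)) x) atTop ∂μ :=
        lintegral_congr_ae hliminf
    _ ≤ liminf (fun k => ∫⁻ x, (s (i k)).indicator (f (i k)) x ∂μ) atTop :=
        lintegral_liminf_le' fun k => (hf (i k)).indicator (hs.measurableSet (i k))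
    _ ≤ C := by
        refine (liminf_le_liminf (.of_forall fun k => ?_)).trans_eq (liminf_const C)
        rw [lintegral_indicator (hs.measurableSet (i k))]
        exact hC (i k)

variable {F : Type*} [NormedAddCommGroup F]

theorem lintegral_enorm_sq_le_lintegral_enorm_sub_sq [InnerProductSpace ℝ F] [CompleteSpace F]
    [IsFiniteMeasure μ] {u : α → F} (hu : MemLp u 2 μ) (hu₀ : ∫ x, u x ∂μ = 0) (c : F) :
    ∫⁻ x, ‖u x‖ₑ ^ 2 ∂μ ≤ ∫⁻ x, ‖c - u x‖ₑ ^ 2 ∂μ := by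
  have hint {v : α → F} (hv : MemLp v 2 μ) : Integrable (fun x => ‖v x‖ ^ 2) μ :=
    hv.integrable_norm_pow two_ne_zero
  have hcu : MemLp (fun x => c - u x) 2 μ := (memLp_const c).sub hu
  have hofReal {v : α → F} (hv : MemLp v 2 μ) :
      ∫⁻ x, ‖v x‖ₑ ^ 2 ∂μ = ENNReal.ofReal (∫ x, ‖v x‖ ^ 2 ∂μ) := by
    rw [ofReal_integral_eq_lintegral_ofReal (hint hv) (.of_forall fun x => sq_nonneg _)]
    simp only [ENNReal.ofReal_pow (norm_nonneg _), ofReal_norm]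
  have huint : Integrable u μ := hu.integrable one_le_two
  have horth : ∫ x, inner ℝ c (u x) ∂μ = 0 := by
    rw [integral_inner huint, hu₀, inner_zero_right]
  rw [hofReal hu, hofReal hcu]
  refine ENNReal.ofReal_le_ofReal ?_
  calc ∫ x, ‖u x‖ ^ 2 ∂μ
      = ∫ x, ‖u x‖ ^ 2 - 2 * inner ℝ c (u x) ∂μ := by
        rw [integral_sub (hint hu) ((huint.const_inner c).const_mul 2), integral_const_mul, horth,
          mul_zero, sub_zero]
    _ ≤ ∫ x, ‖c - u x‖ ^ 2 ∂μ := by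
        refine integral_mono ((hint hu).sub ((huint.const_inner c).const_mul 2)) (hint hcu)
          fun x => ?_
        simp only [norm_sub_sq_real]
        linarith [sq_nonneg ‖c‖]

theorem measure_univ_mul_lintegral_enorm_sq_le [InnerProductSpace ℝ F] [CompleteSpace F]
    [IsFiniteMeasure μ] {ν : Measure α} {u : α → F}
    (hu : MemLp u 2 μ) (huν : AEStronglyMeasurable u ν) (hu₀ : ∫ x, u x ∂μ = 0) :
    ν univ * ∫⁻ x, ‖u x‖ₑ ^ 2 ∂μ ≤ ∫⁻ p, ‖u p.1 - u p.2‖ₑ ^ 2 ∂(ν.prod μ) := by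
  have hmeas : AEMeasurable (fun p : α × α => ‖u p.1 - u p.2‖ₑ ^ 2) (ν.prod μ) :=
    (huν.comp_fst.sub hu.1.comp_snd).enorm.pow_const 2
  rw [lintegral_prod _ hmeas, mul_comm, ← lintegral_const]
  exact lintegral_mono fun y => lintegral_enorm_sq_le_lintegral_enorm_sub_sq hu hu₀ (u y)

end Lintegral

section Segments

variable {E F : Type*} [NormedAddCommGroup E] [NormedSpace ℝ E] [NormedAddCommGroup F]
  [NormedSpace ℝ F]

theorem enorm_sub_rpow_le_lintegral_lineMap [CompleteSpace F] {w : E → F} (hw : ContDiff ℝ 1 w)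
    {p : ℝ} (hp : 1 ≤ p) (x y : E) :
    ‖w x - w y‖ₑ ^ p ≤
      edist x y ^ p * ∫⁻ s in Ioc (0 : ℝ) 1, ‖fderiv ℝ w (lineMap x y s)‖ₑ ^ p := by
  have hcont : Continuous fun s : ℝ => fderiv ℝ w (lineMap x y s) :=
    (hw.continuous_fderiv one_ne_zero).comp (by fun_prop)
  have hmeas : AEMeasurable (fun s : ℝ => ‖fderiv ℝ w (lineMap x y s)‖ₑ)
      (volume.restrict (Ioc (0 : ℝ) 1)) := hcont.enorm.measurable.aemeasurable
  have hprob : IsProbabilityMeasure (volume.restrict (Ioc (0 : ℝ) 1)) := ⟨by simp⟩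
  have hftc : ∫ s in Ioc (0 : ℝ) 1, fderiv ℝ w (lineMap x y s) (y - x) = w y - w x := by
    rw [← intervalIntegral.integral_of_le zero_le_one,
      intervalIntegral.integral_eq_sub_of_hasDerivAt (f := fun s => w (lineMap x y s))
        (fun s _ => (hw.differentiable one_ne_zero _).hasFDerivAt.comp_hasDerivAt s
          hasDerivAt_lineMap)
        ((hcont.clm_apply continuous_const).intervalIntegrable 0 1),
      lineMap_apply_one, lineMap_apply_zero]
  calc ‖w x - w y‖ₑ ^ p
      = ‖∫ s in Ioc (0 : ℝ) 1, fderiv ℝ w (lineMap x y s) (y - x)‖ₑ ^ p := by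
        rw [hftc, ← enorm_neg, neg_sub]
    _ ≤ (∫⁻ s in Ioc (0 : ℝ) 1, edist x y * ‖fderiv ℝ w (lineMap x y s)‖ₑ) ^ p := by
        gcongr
        refine (enorm_integral_le_lintegral_enorm _).trans (lintegral_mono fun s => ?_)
        rw [edist_comm, edist_eq_enorm_sub, mul_comm]
        exact le_opENorm _ _
    _ = edist x y ^ p * (∫⁻ s in Ioc (0 : ℝ) 1, ‖fderiv ℝ w (lineMap x y s)‖ₑ) ^ p := by
        rw [lintegral_const_mul'' _ hmeas, ENNReal.mul_rpow_of_nonneg _ _ (zero_le_one.trans hp)]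
    _ ≤ _ := by
        gcongr
        exact rpow_lintegral_le_lintegral_rpow hmeas hp

variable [MeasurableSpace E] [BorelSpace E] [FiniteDimensional ℝ E] (μ : Measure E)
  [μ.IsAddHaarMeasure]

theorem lintegral_comp_lineMap_right (f : E → ℝ≥0∞) (y : E) {s : ℝ} (hs : s ≠ 0) :
    ∫⁻ x, f (lineMap y x s) ∂μ =
      ENNReal.ofReal |(s ^ Module.finrank ℝ E)⁻¹| * ∫⁻ x, f x ∂μ := by
  simp only [lineMap_apply_module]
  rw [← (measurableEmbedding_const_smul₀ hs).lintegral_map (fun x => f ((1 - s) • y + x)),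
    Measure.map_addHaar_smul μ hs, lintegral_smul_measure, lintegral_add_left_eq_self, smul_eq_mul]

theorem lintegral_comp_lineMap_right_le (f : E → ℝ≥0∞) (y : E) {s : ℝ} (hs : 1 / 2 ≤ s) :
    ∫⁻ x, f (lineMap y x s) ∂μ ≤ 2 ^ Module.finrank ℝ E * ∫⁻ x, f x ∂μ := by
  have hs₀ : 0 < s := one_half_pos.trans_le hs
  have hinv : s⁻¹ ≤ 2 := by
    rw [inv_le_comm₀ hs₀ two_pos]
    linarith
  rw [lintegral_comp_lineMap_right μ f y hs₀.ne', abs_of_pos (by positivity), ← inv_pow,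
    ENNReal.ofReal_pow (by positivity)]
  gcongr
  exact (ENNReal.ofReal_le_ofReal hinv).trans_eq (ENNReal.ofReal_ofNat 2)

theorem setLIntegral_prod_comp_lineMap_le {f : E → ℝ≥0∞} (hf : Measurable f) (A B : Set E)
    (s : ℝ) :
    ∫⁻ p in B ×ˢ A, f (lineMap p.1 p.2 s) ∂(μ.prod μ) ≤
      2 ^ Module.finrank ℝ E * (μ B + μ A) * ∫⁻ z, f z ∂μ := by
  set I : ℝ≥0∞ := 2 ^ Module.finrank ℝ E * ∫⁻ z, f z ∂μ
  have hmeas : Measurable fun p : E × E => f (lineMap p.1 p.2 s) := hf.comp (by fun_prop)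
  have hle : ∫⁻ p in B ×ˢ A, f (lineMap p.1 p.2 s) ∂(μ.prod μ) ≤ (μ B + μ A) * I := by
    -- `lineMap y x s` dilates by `s` in `x` and by `1 - s` in `y`; one is at least `1/2`.
    rcases le_total (1 / 2) s with hs | hs
    · calc ∫⁻ p in B ×ˢ A, f (lineMap p.1 p.2 s) ∂(μ.prod μ)
          = ∫⁻ y in B, ∫⁻ x in A, f (lineMap y x s) ∂μ ∂μ :=
            setLIntegral_prod _ hmeas.aemeasurable
        _ ≤ ∫⁻ _ in B, I ∂μ := lintegral_mono fun y =>
            (setLIntegral_le_lintegral _ _).trans (lintegral_comp_lineMap_right_le μ f y hs)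
        _ = μ B * I := by rw [setLIntegral_const, mul_comm]
        _ ≤ (μ B + μ A) * I := by gcongr; exact le_self_add
    · calc ∫⁻ p in B ×ˢ A, f (lineMap p.1 p.2 s) ∂(μ.prod μ)
          = ∫⁻ x in A, ∫⁻ y in B, f (lineMap x y (1 - s)) ∂μ ∂μ := by
            simp only [lineMap_apply_one_sub]
            exact setLIntegral_prod_symm _ hmeas.aemeasurable
        _ ≤ ∫⁻ _ in A, I ∂μ := lintegral_mono fun x => (setLIntegral_le_lintegral _ _).trans
            (lintegral_comp_lineMap_right_le μ f x (by linarith))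
        _ = μ A * I := by rw [setLIntegral_const, mul_comm]
        _ ≤ (μ B + μ A) * I := by gcongr; exact le_add_self
  exact hle.trans_eq (by ring)

theorem setLIntegral_prod_lintegral_lineMap_le {f : E → ℝ≥0∞} (hf : Measurable f) (A B : Set E) :
    ∫⁻ p in B ×ˢ A, (∫⁻ s in Ioc (0 : ℝ) 1, f (lineMap p.1 p.2 s)) ∂(μ.prod μ) ≤
      2 ^ Module.finrank ℝ E * (μ B + μ A) * ∫⁻ z, f z ∂μ := by
  have hmeas : Measurable fun q : (E × E) × ℝ => f (lineMap q.1.1 q.1.2 q.2) :=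
    hf.comp (by fun_prop)
  calc ∫⁻ p in B ×ˢ A, (∫⁻ s in Ioc (0 : ℝ) 1, f (lineMap p.1 p.2 s)) ∂(μ.prod μ)
      = ∫⁻ s in Ioc (0 : ℝ) 1, ∫⁻ p in B ×ˢ A, f (lineMap p.1 p.2 s) ∂(μ.prod μ) :=
        lintegral_lintegral_swap hmeas.aemeasurable
    _ ≤ ∫⁻ _ in Ioc (0 : ℝ) 1, 2 ^ Module.finrank ℝ E * (μ B + μ A) * ∫⁻ z, f z ∂μ :=
        lintegral_mono fun s => setLIntegral_prod_comp_lineMap_le μ hf A B s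
    _ = 2 ^ Module.finrank ℝ E * (μ B + μ A) * ∫⁻ z, f z ∂μ := by simp

theorem setLIntegral_prod_enorm_sub_rpow_le [CompleteSpace F] {w : E → F} (hw : ContDiff ℝ 1 w)
    {p : ℝ} (hp : 1 ≤ p) {A B : Set E} (hA : MeasurableSet A) (hB : MeasurableSet B)
    (hstar : ∀ y ∈ B, StarConvex ℝ y A) :
    ∫⁻ q in B ×ˢ A, ‖w q.1 - w q.2‖ₑ ^ p ∂(μ.prod μ) ≤
      Metric.ediam A ^ p *
        (2 ^ Module.finrank ℝ E * (μ B + μ A) * ∫⁻ z in A, ‖fderiv ℝ w z‖ₑ ^ p ∂μ) := by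
  set f : E → ℝ≥0∞ := A.indicator fun z => ‖fderiv ℝ w z‖ₑ ^ p with hf
  have hfm : Measurable f :=
    ((hw.continuous_fderiv one_ne_zero).enorm.measurable.pow_const p).indicator hA
  calc ∫⁻ q in B ×ˢ A, ‖w q.1 - w q.2‖ₑ ^ p ∂(μ.prod μ)
      ≤ ∫⁻ q in B ×ˢ A, Metric.ediam A ^ p *
          (∫⁻ s in Ioc (0 : ℝ) 1, f (lineMap q.1 q.2 s)) ∂(μ.prod μ) := by
        refine setLIntegral_mono' (hB.prod hA) fun q hq =>
          (enorm_sub_rpow_le_lintegral_lineMap hw hp q.1 q.2).trans ?_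
        gcongr ?_ ^ p * ?_
        · exact Metric.edist_le_ediam_of_mem ((hstar _ hq.1).mem ⟨_, hq.2⟩) hq.2
        · refine setLIntegral_mono' measurableSet_Ioc fun s hs => ?_
          rw [hf, indicator_of_mem ((hstar _ hq.1).segment_subset hq.2
            (lineMap_mem_segment ℝ _ _ (Ioc_subset_Icc_self hs)))]
    _ = Metric.ediam A ^ p *
          ∫⁻ q in B ×ˢ A, (∫⁻ s in Ioc (0 : ℝ) 1, f (lineMap q.1 q.2 s)) ∂(μ.prod μ) :=
        lintegral_const_mul _ (Measurable.lintegral_prod_right'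
          (f := fun r : (E × E) × ℝ => f (lineMap r.1.1 r.1.2 r.2)) (hfm.comp (by fun_prop)))
    _ ≤ _ := by
        rw [← lintegral_indicator hA]
        gcongr
        exact setLIntegral_prod_lintegral_lineMap_le μ hfm A B

end Segments

section Erosion

/-- The erosion, or inner parallel set, of `s`: the points whose distance to the complement of `s`
is at least `δ`. Mollification by bumps of radius less than `δ` commutes with weak differentiation
there. -/
def erosion {X : Type*} [PseudoMetricSpace X] (δ : ℝ) (s : Set X) : Set X :=
  {x | Metric.ball x δ ⊆ s}

variable {X : Type*} [PseudoMetricSpace X] {s : Set X} {δ : ℝ}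

theorem erosion_subset (hδ : 0 < δ) : erosion δ s ⊆ s :=
  fun _ hx => hx (Metric.mem_ball_self hδ)

theorem closedBall_subset_of_mem_erosion {x : X} (hx : x ∈ erosion δ s) {ε : ℝ} (hε : ε < δ) :
    Metric.closedBall x ε ⊆ s :=
  (Metric.closedBall_subset_ball hε).trans hx

theorem erosion_eq_compl_thickening_compl : erosion δ s = (Metric.thickening δ sᶜ)ᶜ := by
  ext x
  simp only [erosion, mem_ofPred_eq, mem_compl_iff, Metric.mem_thickening_iff, subset_def,
    Metric.mem_ball']
  grind

theorem isClosed_erosion : IsClosed (erosion δ s) := by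
  rw [erosion_eq_compl_thickening_compl]
  exact Metric.isOpen_thickening.isClosed_compl

theorem erosion_prod {Y : Type*} [PseudoMetricSpace Y] {u : Set Y} :
    erosion δ (s ×ˢ u) = erosion δ s ×ˢ erosion δ u := by
  ext ⟨x, y⟩
  simp only [erosion, mem_ofPred_eq, mem_prod, ← ball_prod_same, prod_subset_prod_iff,
    Metric.ball_eq_empty]
  grind [Metric.ball_eq_empty, empty_subset]

theorem aecover_erosion [MeasurableSpace X] [OpensMeasurableSpace X] {μ : Measure X}
    (hs : IsOpen s) {ι : Type*} {l : Filter ι} {δ : ι → ℝ} (hδ : Tendsto δ l (𝓝 0)) :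
    AECover (μ.restrict s) l fun i => erosion (δ i) s where
  ae_eventually_mem := by
    filter_upwards [ae_restrict_mem hs.measurableSet] with x hx
    obtain ⟨ε, hε, hball⟩ := Metric.isOpen_iff.1 hs x hx
    filter_upwards [hδ.eventually_lt_const hε] with i hi
    exact (Metric.ball_subset_ball hi.le).trans hball
  measurableSet _ := isClosed_erosion.measurableSet

theorem starConvex_erosion {E : Type*} [SeminormedAddCommGroup E] [NormedSpace ℝ E] {A B : Set E}
    (hstar : ∀ y ∈ B, StarConvex ℝ y A) {y : E} (hy : y ∈ erosion δ B) :
    StarConvex ℝ y (erosion δ A) := by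
  intro x hx a b ha hb hab z hz
  -- Translate the segment by `v`: its endpoints stay in the balls of radius `δ` around `y` and `x`.
  set v : E := z - (a • y + b • x) with hv
  have hadd {c : E} : c + v ∈ Metric.ball c δ := by
    rwa [mem_ball_iff_norm, add_sub_cancel_left, hv, ← mem_ball_iff_norm]
  have hz' : a • (y + v) + b • (x + v) = z := by
    rw [smul_add, smul_add, add_add_add_comm, ← add_smul, hab, one_smul, hv, add_sub_cancel]
  exact hz' ▸ hstar _ (hy hadd) (hx hadd) ha hb hab

end Erosion

section Convolution

variable {G E : Type*} [AddCommGroup G] [MeasurableSpace G] {μ : Measure G} [NormedAddCommGroup E]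
  [NormedSpace ℝ E]

theorem enorm_convolution_lsmul_le (ψ : G → ℝ) (h : G → E) (x : G) :
    ‖(ψ ⋆[lsmul ℝ ℝ, μ] h) x‖ₑ ≤ ((‖ψ ·‖ₑ) ⋆ₗ[μ] (‖h ·‖ₑ)) x := by
  rw [convolution_def, lconvolution_def]
  refine (enorm_integral_le_lintegral_enorm _).trans_eq (lintegral_congr fun y => ?_)
  rw [lsmul_apply, enorm_smul, sub_eq_neg_add]

variable [MeasurableAdd₂ G] [MeasurableNeg G] [SFinite μ] [μ.IsAddLeftInvariant]

theorem lintegral_lconvolution {f g : G → ℝ≥0∞} (hf : AEMeasurable f μ) (hg : AEMeasurable g μ) :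
    ∫⁻ x, (f ⋆ₗ[μ] g) x ∂μ = (∫⁻ x, f x ∂μ) * ∫⁻ x, g x ∂μ := by
  have hmeas : AEMeasurable (fun q : G × G => f q.2 * g (-q.2 + q.1)) (μ.prod μ) :=
    hf.comp_snd.mul (hg.comp_quasiMeasurePreserving (quasiMeasurePreserving_neg_add_swap μ μ))
  calc ∫⁻ x, (f ⋆ₗ[μ] g) x ∂μ
      = ∫⁻ y, ∫⁻ x, f y * g (-y + x) ∂μ ∂μ := lintegral_lintegral_swap hmeas
    _ = ∫⁻ y, f y * ∫⁻ x, g x ∂μ ∂μ := by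
        refine lintegral_congr fun y => ?_
        have hgy : AEMeasurable (fun x => g (-y + x)) μ :=
          hg.comp_quasiMeasurePreserving (measurePreserving_add_left μ (-y)).quasiMeasurePreserving
        rw [lintegral_const_mul'' _ hgy, lintegral_add_left_eq_self]
    _ = (∫⁻ x, f x ∂μ) * ∫⁻ x, g x ∂μ := lintegral_mul_const'' _ hf

theorem lconvolution_rpow_le {f g : G → ℝ≥0∞} (hf : AEMeasurable f μ) (hf₁ : ∫⁻ x, f x ∂μ = 1)
    (hg : AEMeasurable g μ) {p : ℝ} (hp : 1 ≤ p) (x : G) :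
    (f ⋆ₗ[μ] g) x ^ p ≤ (f ⋆ₗ[μ] fun y => g y ^ p) x := by
  have hgx : AEMeasurable (fun y => g (-y + x)) μ := by
    simp only [neg_add_eq_sub]
    exact hg.comp_quasiMeasurePreserving (quasiMeasurePreserving_sub_left μ x)
  have hprob : IsProbabilityMeasure (μ.withDensity f) :=
    ⟨by rw [withDensity_apply _ .univ, setLIntegral_univ, hf₁]⟩
  have h := rpow_lintegral_le_lintegral_rpow (hgx.mono_ac (withDensity_absolutelyContinuous μ f)) hp
  rwa [lintegral_withDensity_eq_lintegral_mul₀ hf hgx,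
    lintegral_withDensity_eq_lintegral_mul₀ hf (hgx.pow_const p)] at h

theorem lintegral_enorm_convolution_lsmul_rpow_le {ψ : G → ℝ} {h : G → E}
    (hψ : AEStronglyMeasurable ψ μ) (hψ₁ : ∫⁻ x, ‖ψ x‖ₑ ∂μ = 1) (hh : AEStronglyMeasurable h μ)
    {p : ℝ} (hp : 1 ≤ p) :
    ∫⁻ x, ‖(ψ ⋆[lsmul ℝ ℝ, μ] h) x‖ₑ ^ p ∂μ ≤ ∫⁻ x, ‖h x‖ₑ ^ p ∂μ := by
  calc ∫⁻ x, ‖(ψ ⋆[lsmul ℝ ℝ, μ] h) x‖ₑ ^ p ∂μ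
      ≤ ∫⁻ x, ((‖ψ ·‖ₑ) ⋆ₗ[μ] (‖h ·‖ₑ ^ p)) x ∂μ := by
        refine lintegral_mono fun x => le_trans ?_ (lconvolution_rpow_le hψ.enorm hψ₁ hh.enorm hp x)
        gcongr
        exact enorm_convolution_lsmul_le ψ h x
    _ = ∫⁻ x, ‖h x‖ₑ ^ p ∂μ := by
        rw [lintegral_lconvolution hψ.enorm (hh.enorm.pow_const p), hψ₁, one_mul]

end Convolution

section Mollification

theorem locallyIntegrable_indicator_of_memLp {X F : Type*} [TopologicalSpace X] [MeasurableSpace X]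
    [NormedAddCommGroup F] {μ : Measure X} [IsLocallyFiniteMeasure μ] {s : Set X} {u : X → F}
    (hs : MeasurableSet s) {p : ℝ≥0∞} (hp : 1 ≤ p) (hu : MemLp u p (μ.restrict s)) :
    LocallyIntegrable (s.indicator u) μ :=
  ((memLp_indicator_iff_restrict hs).2 hu).locallyIntegrable hp

variable {E F : Type*} [NormedAddCommGroup E]

theorem exists_contDiffBump_seq_tendsto_rOut_zero :
    ∃ φ : ℕ → ContDiffBump (0 : E), Tendsto (fun k => (φ k).rOut) atTop (𝓝 0) ∧
      ∀ k, (φ k).rOut ≤ 2 * (φ k).rIn := by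
  refine ⟨fun k => ⟨(1 / (k + 1 : ℝ)), 2 * (1 / (k + 1 : ℝ)), by positivity,
    lt_mul_of_one_lt_left (by positivity) one_lt_two⟩, ?_, fun k => le_rfl⟩
  simpa using tendsto_one_div_add_atTop_nhds_zero_nat.const_mul (2 : ℝ)

variable [NormedSpace ℝ E] [MeasurableSpace E] [NormedAddCommGroup F] [NormedSpace ℝ F]

/-- The mollification of `u : Ω → F`, extended by zero outside `Ω`, by the normalized bump `φ`. -/
noncomputable def mollification [HasContDiffBump E] (φ : ContDiffBump (0 : E)) (μ : Measure E)
    (Ω : Set E) (u : E → F) : E → F :=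
  φ.normed μ ⋆[lsmul ℝ ℝ, μ] Ω.indicator u

variable [BorelSpace E] [FiniteDimensional ℝ E] {μ : Measure E} [μ.IsAddHaarMeasure]

theorem fderiv_convolution_lsmul_apply [CompleteSpace F] {ψ : E → ℝ} (hψ : HasCompactSupport ψ)
    (hψ₁ : ContDiff ℝ 1 ψ) {h : E → F} (hh : LocallyIntegrable h μ) (z v : E) :
    fderiv ℝ (ψ ⋆[lsmul ℝ ℝ, μ] h) z v = ∫ y, fderiv ℝ ψ (z - y) v • h y ∂μ := by
  rw [← convolution_flip (lsmul ℝ ℝ), (hψ.hasFDerivAt_convolution_right _ hh hψ₁ z).fderiv,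
    convolution_precompR_apply _ hh (hψ.fderiv ℝ) (hψ₁.continuous_fderiv one_ne_zero)]
  rfl

variable [HasContDiffBump E] (φ : ContDiffBump (0 : E)) {Ω : Set E} {u : E → F}

theorem contDiff_mollification [CompleteSpace F] (hu : LocallyIntegrable (Ω.indicator u) μ)
    {k : ℕ∞} :
    ContDiff ℝ k (mollification φ μ Ω u) :=
  φ.hasCompactSupport_normed.contDiff_convolution_left _ φ.contDiff_normed hu

theorem ae_tendsto_mollification [CompleteSpace F] (hΩ : MeasurableSet Ω)
    (hu : LocallyIntegrable (Ω.indicator u) μ) {ι : Type*} {l : Filter ι}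
    {φ : ι → ContDiffBump (0 : E)} (hφ : Tendsto (fun i => (φ i).rOut) l (𝓝 0)) {K : ℝ}
    (hK : ∀ i, (φ i).rOut ≤ K * (φ i).rIn) :
    ∀ᵐ x ∂(μ.restrict Ω), Tendsto (fun i => mollification (φ i) μ Ω u x) l (𝓝 (u x)) := by
  filter_upwards [ae_restrict_mem hΩ, ae_restrict_of_ae
    (ContDiffBump.ae_convolution_tendsto_right_of_locallyIntegrable hφ (.of_forall hK) hu)]
    with x hxΩ hx
  rwa [indicator_of_mem hxΩ] at hx

theorem lintegral_enorm_normed : ∫⁻ x, ‖φ.normed μ x‖ₑ ∂μ = 1 := by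
  simp only [Real.enorm_of_nonneg (φ.nonneg_normed _)]
  rw [← ofReal_integral_eq_lintegral_ofReal φ.integrable_normed (.of_forall φ.nonneg_normed),
    φ.integral_normed, ENNReal.ofReal_one]

theorem lintegral_enorm_mollification_rpow_le (hΩ : MeasurableSet Ω)
    (hu : AEStronglyMeasurable u (μ.restrict Ω)) {p : ℝ} (hp : 1 ≤ p) :
    ∫⁻ x, ‖mollification φ μ Ω u x‖ₑ ^ p ∂μ ≤ ∫⁻ x in Ω, ‖u x‖ₑ ^ p ∂μ := by
  have hp₀ : 0 < p := zero_lt_one.trans_le hp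
  calc ∫⁻ x, ‖mollification φ μ Ω u x‖ₑ ^ p ∂μ
      ≤ ∫⁻ x, ‖Ω.indicator u x‖ₑ ^ p ∂μ :=
        lintegral_enorm_convolution_lsmul_rpow_le φ.continuous_normed.aestronglyMeasurable
          (lintegral_enorm_normed φ) ((aestronglyMeasurable_indicator_iff hΩ).2 hu) hp
    _ = ∫⁻ x in Ω, ‖u x‖ₑ ^ p ∂μ := by
        rw [← lintegral_indicator hΩ]
        refine lintegral_congr fun x => ?_
        by_cases hx : x ∈ Ω
        · simp only [indicator_of_mem hx]
        · simp only [indicator_of_notMem hx, enorm_zero, ENNReal.zero_rpow_of_pos hp₀]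

end Mollification

section WeakDerivative

variable {n : ℕ} {Ω : Set (EuclideanSpace ℝ (Fin n))} {u : EuclideanSpace ℝ (Fin n) → ℝ}

theorem IsWeakPartial.fderiv_mollification_apply_single (hΩ : MeasurableSet Ω) {i : Fin n}
    {g : EuclideanSpace ℝ (Fin n) → ℝ} (hg : IsWeakPartial Ω i u g)
    (hu : LocallyIntegrable (Ω.indicator u)) (φ : ContDiffBump (0 : EuclideanSpace ℝ (Fin n)))
    {z : EuclideanSpace ℝ (Fin n)} (hz : Metric.closedBall z φ.rOut ⊆ Ω) :
    fderiv ℝ (mollification φ volume Ω u) z (EuclideanSpace.single i 1) =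
      mollification φ volume Ω g z := by
  set ψ : EuclideanSpace ℝ (Fin n) → ℝ := fun y => φ.normed volume (z - y) with hψ
  have hψ_supp : Function.support ψ ⊆ Metric.closedBall z φ.rOut := fun y hy => by
    have hmem : z - y ∈ Function.support (φ.normed volume) := hy
    rw [φ.support_normed_eq, mem_ball_zero_iff, norm_sub_rev] at hmem
    exact mem_closedBall_iff_norm.2 hmem.le
  have hψ_fderiv (y : EuclideanSpace ℝ (Fin n)) :
      fderiv ℝ ψ y = -fderiv ℝ (φ.normed volume) (z - y) := by
    have hcomp := (φ.contDiff_normed (μ := volume) (n := 1)).differentiable one_ne_zero (z - y)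
      |>.hasFDerivAt.comp y ((hasFDerivAt_id y).const_sub z)
    exact hcomp.fderiv.trans (by ext; simp)
  have htest := hg.2 ψ (φ.contDiff_normed.comp (contDiff_const.sub contDiff_id))
    (.of_support_subset_isCompact (isCompact_closedBall z _) hψ_supp)
    ((closure_minimal hψ_supp Metric.isClosed_closedBall).trans hz)
  calc fderiv ℝ (mollification φ volume Ω u) z (EuclideanSpace.single i 1)
      = ∫ y, fderiv ℝ (φ.normed volume) (z - y) (EuclideanSpace.single i 1) • Ω.indicator u y :=
        fderiv_convolution_lsmul_apply φ.hasCompactSupport_normed φ.contDiff_normed hu _ _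
    _ = -∫ y in Ω, u y * fderiv ℝ ψ y (EuclideanSpace.single i 1) := by
        rw [← integral_indicator hΩ, ← integral_neg]
        refine integral_congr_ae (.of_forall fun y => ?_)
        by_cases hy : y ∈ Ω <;> simp [hy, hψ_fderiv, mul_comm]
    _ = ∫ y in Ω, g y * ψ y := by rw [htest, neg_neg]
    _ = ∫ y, φ.normed volume (z - y) • Ω.indicator g y := by
        rw [← integral_indicator hΩ]
        refine integral_congr_ae (.of_forall fun y => ?_)
        by_cases hy : y ∈ Ω <;> simp [hy, hψ, mul_comm]
    _ = mollification φ volume Ω g z := (convolution_eq_swap (lsmul ℝ ℝ)).symm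

theorem enorm_sq_eq_sum_enorm_apply_sq {E ι : Type*} [NormedAddCommGroup E]
    [InnerProductSpace ℝ E] [Fintype ι] (b : OrthonormalBasis ι ℝ E) (L : StrongDual ℝ E) :
    ‖L‖ₑ ^ 2 = ∑ i, ‖L (b i)‖ₑ ^ 2 := by
  rw [← ofReal_norm, ← ENNReal.ofReal_pow (norm_nonneg L), b.norm_dual L,
    ENNReal.ofReal_sum_of_nonneg fun i _ => sq_nonneg _]
  refine Finset.sum_congr rfl fun i _ => ?_
  rw [Real.enorm_eq_ofReal_abs, ← ENNReal.ofReal_pow (abs_nonneg _), sq_abs]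

theorem setLIntegral_enorm_fderiv_mollification_sq_le {A : Set (EuclideanSpace ℝ (Fin n))}
    {g : Fin n → EuclideanSpace ℝ (Fin n) → ℝ} (hΩ : MeasurableSet Ω) (hA : MeasurableSet A)
    (hu : LocallyIntegrable (Ω.indicator u)) (hg : ∀ i, IsWeakPartial Ω i u (g i))
    (φ : ContDiffBump (0 : EuclideanSpace ℝ (Fin n)))
    (hAΩ : ∀ z ∈ A, Metric.closedBall z φ.rOut ⊆ Ω) :
    ∫⁻ z in A, ‖fderiv ℝ (mollification φ volume Ω u) z‖ₑ ^ 2 ≤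
      ∑ i, ∫⁻ y in Ω, ‖g i y‖ₑ ^ 2 := by
  have hmeas (i : Fin n) : Measurable fun z => ‖mollification φ volume Ω (g i) z‖ₑ ^ 2 :=
    (contDiff_mollification φ (k := 0) (locallyIntegrable_indicator_of_memLp hΩ one_le_two
      (hg i).1)).continuous.enorm.measurable.pow_const 2
  calc ∫⁻ z in A, ‖fderiv ℝ (mollification φ volume Ω u) z‖ₑ ^ 2
      = ∫⁻ z in A, ∑ i, ‖mollification φ volume Ω (g i) z‖ₑ ^ 2 := by
        refine setLIntegral_congr_fun hA fun z hz => ?_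
        simp only [enorm_sq_eq_sum_enorm_apply_sq (EuclideanSpace.basisFun (Fin n) ℝ),
          EuclideanSpace.basisFun_apply,
          (hg _).fderiv_mollification_apply_single hΩ hu φ (hAΩ z hz)]
    _ = ∑ i, ∫⁻ z in A, ‖mollification φ volume Ω (g i) z‖ₑ ^ 2 :=
        lintegral_finsetSum _ fun i _ => hmeas i
    _ ≤ ∑ i, ∫⁻ y in Ω, ‖g i y‖ₑ ^ 2 := by
        refine Finset.sum_le_sum fun i _ => (setLIntegral_le_lintegral _ _).trans ?_
        simpa only [ENNReal.rpow_two] using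
          lintegral_enorm_mollification_rpow_le φ hΩ (hg i).1.1 one_le_two

end WeakDerivative

section StarShaped

variable {n : ℕ} {Ω B : Set (EuclideanSpace ℝ (Fin n))} {u : EuclideanSpace ℝ (Fin n) → ℝ}

theorem IsStarShapedWrt.starConvex (hstar : IsStarShapedWrt Ω B) {y : EuclideanSpace ℝ (Fin n)}
    (hy : y ∈ B) : StarConvex ℝ y Ω :=
  starConvex_iff_segment_subset.2 fun x hx =>
    Subset.trans (segment_subset_convexHull (Or.inl hy) (Or.inr rfl)) (hstar.2 x hx)

theorem setLIntegral_erosion_enorm_mollification_sub_sq_le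
    {g : Fin n → EuclideanSpace ℝ (Fin n) → ℝ} (hΩ : MeasurableSet Ω)
    (hstar : ∀ y ∈ B, StarConvex ℝ y Ω) (hu : LocallyIntegrable (Ω.indicator u))
    (hg : ∀ i, IsWeakPartial Ω i u (g i)) {φ : ContDiffBump (0 : EuclideanSpace ℝ (Fin n))} {δ : ℝ}
    (hδ : φ.rOut < δ) :
    ∫⁻ q in erosion δ (B ×ˢ Ω),
        ‖mollification φ volume Ω u q.1 - mollification φ volume Ω u q.2‖ₑ ^ 2
          ∂(volume.prod volume) ≤
      Metric.ediam Ω ^ 2 * (2 ^ n * (volume B + volume Ω) * ∑ i, ∫⁻ z in Ω, ‖g i z‖ₑ ^ 2) := by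
  have hδ₀ : 0 < δ := φ.rOut_pos.trans hδ
  have hgrad := setLIntegral_enorm_fderiv_mollification_sq_le hΩ
    (isClosed_erosion (s := Ω)).measurableSet hu hg φ
    fun z hz => closedBall_subset_of_mem_erosion hz hδ
  have hdiff := setLIntegral_prod_enorm_sub_rpow_le volume (contDiff_mollification φ hu (k := 1))
    one_le_two (isClosed_erosion (s := Ω)).measurableSet (isClosed_erosion (s := B)).measurableSet
    fun y hy => starConvex_erosion (δ := δ) hstar hy
  simp only [ENNReal.rpow_two, finrank_euclideanSpace_fin] at hdiff
  rw [erosion_prod]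
  refine hdiff.trans ?_
  gcongr
  · exact erosion_subset hδ₀
  · exact erosion_subset hδ₀
  · exact erosion_subset hδ₀

theorem IsStarShapedWrt.setLIntegral_prod_enorm_sub_sq_le (hstar : IsStarShapedWrt Ω B)
    (hΩ : IsOpen Ω) (hB : IsOpen B) {g : Fin n → EuclideanSpace ℝ (Fin n) → ℝ}
    (hu : MemLp u 2 (volume.restrict Ω)) (hg : ∀ i, IsWeakPartial Ω i u (g i)) :
    ∫⁻ q in B ×ˢ Ω, ‖u q.1 - u q.2‖ₑ ^ 2 ∂(volume.prod volume) ≤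
      Metric.ediam Ω ^ 2 * (2 ^ n * (volume B + volume Ω) * ∑ i, ∫⁻ z in Ω, ‖g i z‖ₑ ^ 2) := by
  have hloc := locallyIntegrable_indicator_of_memLp hΩ.measurableSet one_le_two hu
  obtain ⟨φ, hφ, hφ₂⟩ := exists_contDiffBump_seq_tendsto_rOut_zero (E := EuclideanSpace ℝ (Fin n))
  have hlim := ae_tendsto_mollification hΩ.measurableSet hloc hφ hφ₂
  have hδ : Tendsto (fun k => 2 * (φ k).rOut) atTop (𝓝 0) := by simpa using hφ.const_mul 2
  have hlimB := ae_restrict_of_ae_restrict_of_subset hstar.1 hlim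
  refine lintegral_le_of_aecover_of_ae_tendsto (aecover_erosion (hB.prod hΩ) hδ)
    (f := fun k q => ‖mollification (φ k) volume Ω u q.1 - mollification (φ k) volume Ω u q.2‖ₑ ^ 2)
    (fun k => ?_) ?_ fun k => ?_
  · have hcont := (contDiff_mollification (φ k) hloc (k := 0)).continuous
    exact Continuous.aemeasurable (by fun_prop)
  · rw [← Measure.prod_restrict]
    filter_upwards [Measure.quasiMeasurePreserving_fst.ae hlimB,
      Measure.quasiMeasurePreserving_snd.ae hlim] with q hq₁ hq₂
    exact ENNReal.Tendsto.pow (hq₁.sub hq₂).enorm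
  · rw [Measure.restrict_restrict_of_subset (erosion_subset (by linarith [(φ k).rOut_pos]))]
    exact setLIntegral_erosion_enorm_mollification_sub_sq_le hΩ.measurableSet
      (fun y hy => hstar.starConvex hy) hloc hg (by linarith [(φ k).rOut_pos])

theorem ofReal_l2Norm_sq (hu : MemLp u 2 (volume.restrict Ω)) :
    ENNReal.ofReal (l2Norm Ω u ^ 2) = ∫⁻ x in Ω, ‖u x‖ₑ ^ 2 := by
  rw [l2Norm, ENNReal.ofReal_pow ENNReal.toReal_nonneg, ENNReal.ofReal_toReal hu.2.ne]
  simpa only [NNReal.coe_ofNat, ENNReal.coe_ofNat, ENNReal.rpow_two] using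
    eLpNorm_nnreal_pow_eq_lintegral (f := u) (μ := volume.restrict Ω) (p := 2) two_ne_zero

theorem MemH1.isWeakPartial_weakPartial (hu : MemH1 Ω u) (i : Fin n) :
    IsWeakPartial Ω i u (weakPartial Ω i u) := by
  rw [weakPartial, dif_pos (hu.2 i)]
  exact (hu.2 i).choose_spec

theorem MemH1.ofReal_h1Seminorm_sq (hu : MemH1 Ω u) :
    ENNReal.ofReal (h1Seminorm Ω u ^ 2) = ∑ i, ∫⁻ x in Ω, ‖weakPartial Ω i u x‖ₑ ^ 2 := by
  have hsq (i : Fin n) : 0 ≤ l2Norm Ω (weakPartial Ω i u) ^ 2 := sq_nonneg _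
  rw [h1Seminorm, Real.sq_sqrt (Finset.sum_nonneg fun i _ => hsq i),
    ENNReal.ofReal_sum_of_nonneg fun i _ => hsq i]
  exact Finset.sum_congr rfl fun i _ => ofReal_l2Norm_sq (hu.isWeakPartial_weakPartial i).1

theorem MemH1.l2Norm_le_of_isStarShapedWrt (hu : MemH1 Ω u) (hu₀ : ∫ x in Ω, u x = 0)
    (hstar : IsStarShapedWrt Ω B) (hΩ : IsOpen Ω) (hΩb : Bornology.IsBounded Ω) (hB : IsOpen B)
    (hBne : B.Nonempty) :
    l2Norm Ω u ≤ √(2 ^ n * (1 + volume.real Ω / volume.real B)) * Metric.diam Ω *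
      h1Seminorm Ω u := by
  have hΩfin : volume Ω ≠ ⊤ := hΩb.measure_lt_top.ne
  have hBfin : volume B ≠ ⊤ := measure_ne_top_of_subset hstar.1 hΩfin
  have hBpos : 0 < volume.real B := ENNReal.toReal_pos (hB.measure_pos volume hBne).ne' hBfin
  have : IsFiniteMeasure (volume.restrict Ω) := ⟨by simpa using hΩfin.lt_top⟩
  have hmean : volume B * ∫⁻ x in Ω, ‖u x‖ₑ ^ 2 ≤
      ∫⁻ q in B ×ˢ Ω, ‖u q.1 - u q.2‖ₑ ^ 2 ∂(volume.prod volume) := by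
    simpa only [Measure.restrict_apply_univ, Measure.prod_restrict] using
      measure_univ_mul_lintegral_enorm_sq_le hu.1
        (hu.1.1.mono_measure (Measure.restrict_mono hstar.1 le_rfl)) hu₀
  have henorm := hmean.trans
    (hstar.setLIntegral_prod_enorm_sub_sq_le hΩ hB hu.1 hu.isWeakPartial_weakPartial)
  rw [← ofReal_l2Norm_sq hu.1, ← hu.ofReal_h1Seminorm_sq] at henorm
  have hdiam : Metric.ediam Ω ≠ ⊤ := hΩb.ediam_ne_top
  have hreal : volume.real B * l2Norm Ω u ^ 2 ≤ Metric.diam Ω ^ 2 *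
      (2 ^ n * (volume.real B + volume.real Ω) * h1Seminorm Ω u ^ 2) := by
    simpa only [Measure.real, Metric.diam, ENNReal.toReal_mul, ENNReal.toReal_pow,
      ENNReal.toReal_add hBfin hΩfin, ENNReal.toReal_ofNat,
      ENNReal.toReal_ofReal (sq_nonneg _)] using
      ENNReal.toReal_mono (by finiteness) henorm
  have hK : 0 ≤ 2 ^ n * (1 + volume.real Ω / volume.real B) := by positivity
  have hh1 : 0 ≤ h1Seminorm Ω u := Real.sqrt_nonneg _
  refine le_of_sq_le_sq ?_ (by positivity)
  rw [mul_pow, mul_pow, Real.sq_sqrt hK]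
  refine le_of_mul_le_mul_left (hreal.trans_eq ?_) hBpos
  field_simp

end StarShaped

section Elementary

theorem sqrt_le_mul_one_add_log_rpow {p a V : ℝ} (hp : 2 ≤ p) (ha : 2 ≤ a) (hV : 1 ≤ V)
    (hVa : V ≤ a ^ p) :
    √V ≤ a * (1 + Real.log V ^ (p / (2 * (p - 1))) * V ^ ((p - 2) / (2 * (p - 1)))) := by
  have hp₁ : 0 < 2 * (p - 1) := by linarith
  have hV₀ : 0 < V := one_pos.trans_le hV
  rcases le_total V (Real.exp 1) with hVe | hVe
  · have hlog : 0 ≤ Real.log V := Real.log_nonneg hV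
    calc √V ≤ 2 := by
          rw [Real.sqrt_le_left two_pos.le]
          linarith [Real.exp_one_lt_d9]
      _ ≤ a * (1 + 0) := by linarith
      _ ≤ _ := by gcongr; positivity
  · have hlog : 1 ≤ Real.log V := by rwa [Real.le_log_iff_exp_le hV₀]
    have hlog_rpow : 1 ≤ Real.log V ^ (p / (2 * (p - 1))) :=
      Real.one_le_rpow hlog (by positivity)
    have hV_rpow : V ^ (1 / (2 * (p - 1))) ≤ a :=
      calc V ^ (1 / (2 * (p - 1))) ≤ (a ^ p) ^ (1 / (2 * (p - 1))) := by gcongr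
        _ = a ^ (p / (2 * (p - 1))) := by rw [← Real.rpow_mul (by linarith), mul_one_div]
        _ ≤ a ^ (1 : ℝ) := by
            refine Real.rpow_le_rpow_of_exponent_le (by linarith) ?_
            rw [div_le_one hp₁]
            linarith
        _ = a := Real.rpow_one a
    calc √V = V ^ (1 / (2 * (p - 1))) * V ^ ((p - 2) / (2 * (p - 1))) := by
          rw [Real.sqrt_eq_rpow, ← Real.rpow_add hV₀]
          have hp₀ : p - 1 ≠ 0 := by linarith
          congr 1
          field_simp
          ring
      _ ≤ a * (1 * V ^ ((p - 2) / (2 * (p - 1)))) := by rw [one_mul]; gcongr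
      _ ≤ a * (Real.log V ^ (p / (2 * (p - 1))) * V ^ ((p - 2) / (2 * (p - 1)))) := by gcongr
      _ ≤ _ := by gcongr; linarith

theorem measureReal_div_measureReal_ball_le {E : Type*} [NormedAddCommGroup E] [NormedSpace ℝ E]
    [FiniteDimensional ℝ E] [MeasurableSpace E] [BorelSpace E] (μ : Measure E) [μ.IsAddHaarMeasure]
    {s : Set E} (hs : Bornology.IsBounded s) {x : E} (hx : x ∈ s) {r : ℝ} (hr : 0 < r) :
    μ.real s / μ.real (Metric.ball x r) ≤ (Metric.diam s / r) ^ Module.finrank ℝ E := by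
  have hunit : 0 < μ.real (Metric.ball (0 : E) 1) :=
    ENNReal.toReal_pos (Metric.measure_ball_pos _ _ one_pos).ne' measure_ball_lt_top.ne
  have hball : μ.real (Metric.ball x r) =
      r ^ Module.finrank ℝ E * μ.real (Metric.ball (0 : E) 1) := by
    rw [Measure.real, Measure.addHaar_ball_of_pos μ x hr, ENNReal.toReal_mul,
      ENNReal.toReal_ofReal (by positivity), Measure.real]
  have hsub : s ⊆ Metric.closedBall x (Metric.diam s) :=
    fun y hy => Metric.dist_le_diam_of_mem hs hy hx
  calc μ.real s / μ.real (Metric.ball x r)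
      ≤ μ.real (Metric.closedBall x (Metric.diam s)) / μ.real (Metric.ball x r) := by
        gcongr
        exact measure_closedBall_lt_top.ne
    _ = (Metric.diam s / r) ^ Module.finrank ℝ E := by
        rw [Measure.addHaar_real_closedBall μ x Metric.diam_nonneg, hball,
          mul_div_mul_right _ _ hunit.ne', div_pow]

end Elementary

theorem mainTheorem6 (n : ℕ) (hn : 2 ≤ n) :
    ∃ C : ℝ, 0 < C ∧
      ∀ (Ω : Set (EuclideanSpace ℝ (Fin n))) (x₀ : EuclideanSpace ℝ (Fin n)) (r : ℝ),
        IsOpen Ω → Bornology.IsBounded Ω → 0 < r → IsStarShapedWrt Ω (Metric.ball x₀ r) →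
        ∃ K : ℝ, 0 ≤ K ∧
          (∀ u : EuclideanSpace ℝ (Fin n) → ℝ, MemH1 Ω u → ∫ x in Ω, u x = 0 →
            l2Norm Ω u ≤ K * Metric.diam Ω * h1Seminorm Ω u) ∧
          K ≤ C * (Metric.diam Ω / Metric.diam (Metric.ball x₀ r)) *
            (1 + Real.log (volume.real Ω / volume.real (Metric.ball x₀ r)) ^
                  ((n : ℝ) / (2 * ((n : ℝ) - 1))) *
                (volume.real Ω / volume.real (Metric.ball x₀ r)) ^
                  (((n : ℝ) - 2) / (2 * ((n : ℝ) - 1)))) := by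
  refine ⟨2 * √(2 ^ (n + 1)), by positivity, fun Ω x₀ r hΩ hΩb hr hstar =>
    ⟨√(2 ^ n * (1 + volume.real Ω / volume.real (Metric.ball x₀ r))), Real.sqrt_nonneg _,
      fun u hu hu₀ => hu.l2Norm_le_of_isStarShapedWrt hu₀ hstar hΩ hΩb Metric.isOpen_ball
        (Metric.nonempty_ball.2 hr), ?_⟩⟩
  have : Nontrivial (Fin n) := Fin.nontrivial_iff_two_le.2 hn
  have hdiam : Metric.diam (Metric.ball x₀ r) = 2 * r := Metric.diam_ball_eq x₀ hr.le
  have hdiam_le := Metric.diam_mono hstar.1 hΩb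
  have hratio : 2 * (Metric.diam Ω / Metric.diam (Metric.ball x₀ r)) = Metric.diam Ω / r := by
    rw [hdiam]
    field_simp
  set V : ℝ := volume.real Ω / volume.real (Metric.ball x₀ r)
  have hV : 1 ≤ V := (one_le_div (ENNReal.toReal_pos (Metric.measure_ball_pos _ _ hr).ne'
    measure_ball_lt_top.ne)).2 (measureReal_mono hstar.1 hΩb.measure_lt_top.ne)
  have hV_le : V ≤ (Metric.diam Ω / r) ^ (n : ℝ) := by
    simpa only [Real.rpow_natCast, finrank_euclideanSpace_fin] using
      measureReal_div_measureReal_ball_le volume hΩb (hstar.1 (Metric.mem_ball_self hr)) hr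
  have hsqrt := sqrt_le_mul_one_add_log_rpow (Nat.ofNat_le_cast.2 hn)
    ((le_div_iff₀ hr).2 (hdiam ▸ hdiam_le)) hV hV_le
  calc √(2 ^ n * (1 + V)) ≤ √(2 ^ (n + 1) * V) :=
        Real.sqrt_le_sqrt (by rw [pow_succ, mul_assoc]; gcongr; linarith)
    _ = √(2 ^ (n + 1)) * √V := Real.sqrt_mul (by positivity) V
    _ ≤ _ := (mul_le_mul_of_nonneg_left hsqrt (Real.sqrt_nonneg _)).trans_eq
        (by rw [← hratio]; ring)
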